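/- Let $n\ge 3$, let $\mathbb S^n\subset\mathbb R^{n+1}$ be the unit sphere with its round metric $g_{\mathbb S^n}$, let $\Omega\subset\mathbb S^n$ be open and let $\rho:\Omega\to\mathbb R$ be smooth. Consider the conformal metric $\hat g=e^{2\rho}g_{\mathbb S^n}$ on $\Omega$ and its Schouten tensor $$\mathrm{Sch}_{\hat g}=\frac1{n-2}\Big(\mathrm{Ric}_{\hat g}-\frac{S_{\hat g}}{2(n-1)}\,\hat g\Big),$$ where $\mathrm{Ric}_{\hat g}$ and $S_{\hat g}$ are the Ricci and scalar curvature of $\hat g$. Let $$\mathbb H^{n+1}=\{(x_0,x)\in\mathbb R\times\mathbb R^{n+1}:\ -x_0^2+|x|^2=-1,\ x_0>0\}$$ be hyperbolic space in Minkowski spacetime $\mathbb R^{1,n+1}$, and for $t\in\mathbb R$ define $\phi_t$ on $\Omega$ by $$\phi_t(x)=\frac{e^{\rho+t}}2\Big(1+e^{-2\rho-2t}\big(1+|\nabla\rho|^2\big)\Big)(1,x)+e^{-\rho-t}\,(0,-x+\nabla\rho),$$ where $\rho=\rho(x)$, and $\nabla\rho=\nabla\rho(x)$ (regarded as a vector in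 $\mathbb R^{n+1}$ tangent to $\mathbb S^n$ at $x$) and its norm are taken with respect to $g_{\mathbb S^n}$. Suppose that the Schouten tensor of $\hat g$ is bounded from above, i.e. there is a constant $C$ with $\mathrm{Sch}_{\hat g}(v,v)\le C\,\hat g(v,v)$ for all $x\in\Omega$ and $v\in T_x\mathbb S^n$. Then there is $t_0\in\mathbb R$ such that for every $t\ge t_0$ the map $\phi_t$ is a smooth immersion of $\Omega$ into $\mathbb H^{n+1}$, that is, it takes values in $\mathbb H^{n+1}$, is smooth, and its differential is injective at every point of $\Omega$. -/

import Mathlib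

open scoped Manifold ContDiff

noncomputable section

namespace HoroImmersion

/-! ### Riemannian curvature in coordinates

A metric on (an open part of) `ℝⁿ` is given by its matrix of components `g y i j = g_{ij}(y)`. -/

section Coordinates

variable {n : ℕ}

/-- The partial derivative `∂_i f` at `y`. -/
def pderiv (f : EuclideanSpace ℝ (Fin n) → ℝ) (i : Fin n) (y : EuclideanSpace ℝ (Fin n)) : ℝ :=
  fderiv ℝ f y (EuclideanSpace.single i 1)

/-- The Christoffel symbol
`Γ^k_{ij} = ½ ∑_l g^{kl} (∂_i g_{jl} + ∂_j g_{il} - ∂_l g_{ij})`. -/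
def christoffel (g : EuclideanSpace ℝ (Fin n) → Matrix (Fin n) (Fin n) ℝ) (k i j : Fin n)
    (y : EuclideanSpace ℝ (Fin n)) : ℝ :=
  (1 / 2) * ∑ l, (g y)⁻¹ k l *
    (pderiv (fun z => g z j l) i y + pderiv (fun z => g z i l) j y - pderiv (fun z => g z i j) l y)

/-- The curvature tensor `R(∂_i, ∂_j) ∂_k = ∑_l R^l_{kij} ∂_l`, that is
`R^l_{kij} = ∂_i Γ^l_{jk} - ∂_j Γ^l_{ik} + ∑_m (Γ^l_{im} Γ^m_{jk} - Γ^l_{jm} Γ^m_{ik})`. -/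
def riemann (g : EuclideanSpace ℝ (Fin n) → Matrix (Fin n) (Fin n) ℝ) (l k i j : Fin n)
    (y : EuclideanSpace ℝ (Fin n)) : ℝ :=
  pderiv (christoffel g l j k) i y - pderiv (christoffel g l i k) j y +
    ∑ m, (christoffel g l i m y * christoffel g m j k y -
      christoffel g l j m y * christoffel g m i k y)

/-- The Ricci tensor `Ric_{jk} = ∑_i R^i_{kij}` (positive on round spheres). -/
def ricci (g : EuclideanSpace ℝ (Fin n) → Matrix (Fin n) (Fin n) ℝ)
    (y : EuclideanSpace ℝ (Fin n)) : Matrix (Fin n) (Fin n) ℝ :=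
  Matrix.of fun j k => ∑ i, riemann g i k i j y

/-- The scalar curvature `S = ∑_{j,k} g^{jk} Ric_{jk}`. -/
def scalarCurvature (g : EuclideanSpace ℝ (Fin n) → Matrix (Fin n) (Fin n) ℝ)
    (y : EuclideanSpace ℝ (Fin n)) : ℝ :=
  ∑ j, ∑ k, (g y)⁻¹ j k * ricci g y j k

/-- The Schouten tensor `Sch = 1/(n-2) (Ric - S/(2(n-1)) g)`, meaningful for `n ≥ 3`. -/
def schouten (g : EuclideanSpace ℝ (Fin n) → Matrix (Fin n) (Fin n) ℝ)
    (y : EuclideanSpace ℝ (Fin n)) : Matrix (Fin n) (Fin n) ℝ :=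
  (1 / ((n : ℝ) - 2)) • (ricci g y - (scalarCurvature g y / (2 * ((n : ℝ) - 1))) • g y)

end Coordinates

/-! ### The round sphere and its conformal metrics -/

/-- The unit sphere `𝕊ⁿ` in `ℝⁿ⁺¹`. -/
abbrev Sph (n : ℕ) : Type := Metric.sphere (0 : EuclideanSpace ℝ (Fin (n + 1))) 1

section Sphere

variable {n : ℕ}

/-- The local parametrization of `𝕊ⁿ ⊂ ℝⁿ⁺¹` inverse to the preferred (stereographic) chart
around `x`. -/
def param (x : Sph n) (y : EuclideanSpace ℝ (Fin n)) : EuclideanSpace ℝ (Fin (n + 1)) :=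
  ((chartAt (EuclideanSpace ℝ (Fin n)) x).symm y : Sph n)

/-- The coordinates of `x` in the preferred chart around `x`. -/
def coord (x : Sph n) : EuclideanSpace ℝ (Fin n) := chartAt (EuclideanSpace ℝ (Fin n)) x x

/-- The coordinate vector field `∂_i` of the chart around `x`, as a vector in `ℝⁿ⁺¹`. -/
def coordVec (x : Sph n) (i : Fin n) (y : EuclideanSpace ℝ (Fin n)) :
    EuclideanSpace ℝ (Fin (n + 1)) :=
  fderiv ℝ (param x) y (EuclideanSpace.single i 1)

/-- The components of the round metric `g_{𝕊ⁿ}`, induced from `ℝⁿ⁺¹`, in the chart around `x`. -/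
def roundMetric (x : Sph n) (y : EuclideanSpace ℝ (Fin n)) : Matrix (Fin n) (Fin n) ℝ :=
  Matrix.of fun i j => inner ℝ (coordVec x i y) (coordVec x j y)

/-- A function on `𝕊ⁿ` in the chart around `x`. -/
def inChart (ρ : Sph n → ℝ) (x : Sph n) (y : EuclideanSpace ℝ (Fin n)) : ℝ :=
  ρ ((chartAt (EuclideanSpace ℝ (Fin n)) x).symm y)

/-- The components of the conformal metric `ĝ = e^{2ρ} g_{𝕊ⁿ}` in the chart around `x`. -/
def conformalMetric (ρ : Sph n → ℝ) (x : Sph n) (y : EuclideanSpace ℝ (Fin n)) :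
    Matrix (Fin n) (Fin n) ℝ :=
  Real.exp (2 * inChart ρ x y) • roundMetric x y

/-- The Schouten tensor of `ĝ = e^{2ρ} g_{𝕊ⁿ}` is bounded from above on `Ω`: for some constant `C`,
`Sch_ĝ (v, v) ≤ C ĝ (v, v)` for all vectors `v = ∑ vⁱ ∂_i` tangent to `𝕊ⁿ` at points `x` of `Ω`;
equivalently the eigenvalues of `ĝ⁻¹ Sch_ĝ` are at most `C`. -/
def SchoutenBoundedAbove (ρ : Sph n → ℝ) (Ω : Set (Sph n)) : Prop :=
  ∃ C : ℝ, ∀ x ∈ Ω, ∀ v : Fin n → ℝ,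
    ∑ i, ∑ j, schouten (conformalMetric ρ x) (coord x) i j * v i * v j ≤
      C * ∑ i, ∑ j, conformalMetric ρ x (coord x) i j * v i * v j

/-- The gradient `∇ρ = ∑_{i,j} g^{ij} ∂_jρ ∂_i` with respect to the round metric, as a vector
in `ℝⁿ⁺¹` tangent to `𝕊ⁿ` at `x`. -/
def sphereGrad (ρ : Sph n → ℝ) (x : Sph n) : EuclideanSpace ℝ (Fin (n + 1)) :=
  ∑ i, ∑ j, ((roundMetric x (coord x))⁻¹ i j * pderiv (inChart ρ x) j (coord x)) •
    coordVec x i (coord x)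

end Sphere

/-! ### Hyperbolic space and the representation formula -/

/-- The vector space underlying the Minkowski spacetime `ℝ^{1,n+1}`; points are `(x₀, x)`. -/
abbrev Minkowski (n : ℕ) : Type := ℝ × EuclideanSpace ℝ (Fin (n + 1))

/-- Hyperbolic space `ℍⁿ⁺¹`: the points with `-x₀² + |x|² = -1` and `x₀ > 0`. -/
def hyperbolicSpace (n : ℕ) : Set (Minkowski n) :=
  {p | -p.1 ^ 2 + ‖p.2‖ ^ 2 = -1 ∧ 0 < p.1}

/-- The map
`φ_t = e^{ρ+t}/2 (1 + e^{-2ρ-2t} (1 + |∇ρ|²)) (1, x) + e^{-ρ-t} (0, -x + ∇ρ)`. -/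
def phi {n : ℕ} (ρ : Sph n → ℝ) (t : ℝ) (x : Sph n) : Minkowski n :=
  (Real.exp (ρ x + t) / 2 *
      (1 + Real.exp (-2 * ρ x - 2 * t) * (1 + ‖sphereGrad ρ x‖ ^ 2))) •
    ((1 : ℝ), (x : EuclideanSpace ℝ (Fin (n + 1)))) +
  Real.exp (-ρ x - t) •
    ((0 : ℝ), -(x : EuclideanSpace ℝ (Fin (n + 1))) + sphereGrad ρ x)

/-- `f` restricts to a smooth immersion of the open set `Ω ⊆ 𝕊ⁿ` into `ℍⁿ⁺¹`. As `ℍⁿ⁺¹` is an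
embedded submanifold of `ℝ^{1,n+1}`, smoothness and injectivity of the differential may be
read off in the ambient vector space. -/
def IsImmersionIntoHyperbolic {n : ℕ} (f : Sph n → Minkowski n) (Ω : Set (Sph n)) : Prop :=
  Set.MapsTo f Ω (hyperbolicSpace n) ∧
  ContMDiffOn (𝓡 n) 𝓘(ℝ, Minkowski n) ∞ f Ω ∧
  ∀ x ∈ Ω, Function.Injective (mfderiv (𝓡 n) 𝓘(ℝ, Minkowski n) f x)

end HoroImmersion

end

open HoroImmersion

/-! Suppose `dφ_t` kills a tangent vector `v` at `x`. Its time component says that the coefficient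
of `(1, x)` has zero derivative along `v`. Pairing the space component with `v` then leaves a scalar
identity, `e^{2t} e^{2ρ} |v|² / 2 = |v|²/2 - Hess ρ(v,v) + dρ(v)² - |∇ρ|²|v|²/2`. Its right side is
exactly `Sch_ĝ(v,v)`, so `Sch_ĝ(v,v) = (e^{2t}/2) ĝ(v,v)`. If `Sch_ĝ ≤ C ĝ` and `e^{2t} > 2C`, this
forces `v = 0`.

The kernel identity is `inner_eq_of_fderiv_horoMap_eq_zero`; the Schouten formula is
`schouten_conformalMetric_apply_self`. For the latter, stereographic projection turns `ĝ` into
`e^{2u} δ` with `u = ρ - log(1 + |y|²/4)`, where the Schouten tensor is `-D²u + du ⊗ du - |du|² δ /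
2` (`schouten_flatConformal`).

To compare the two, `ρ` is replaced by its extension to `ℝⁿ⁺¹ \ {0}` constant on rays: on the sphere
its Euclidean gradient is `∇ρ`, and `φ_t` becomes the restriction of a map between vector spaces. -/

namespace HoroImmersion

/-! ### The Schouten tensor of a conformally flat metric -/

section ConformallyFlat

variable {n : ℕ}

/-- The flat metric of `ℝⁿ` multiplied by `e^{2u}`. -/
noncomputable def flatConformal (u : EuclideanSpace ℝ (Fin n) → ℝ) (y : EuclideanSpace ℝ (Fin n)) :
    Matrix (Fin n) (Fin n) ℝ :=
  Real.exp (2 * u y) • (1 : Matrix (Fin n) (Fin n) ℝ)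

/-- The Christoffel symbols of `e^{2u} δ`, in terms of the differential `p` of `u`. -/
noncomputable def flatChristoffel (p : Fin n → ℝ) (k i j : Fin n) : ℝ :=
  (if k = j then p i else 0) + (if k = i then p j else 0) - (if i = j then p k else 0)

theorem inv_flatConformal (u : EuclideanSpace ℝ (Fin n) → ℝ) (y : EuclideanSpace ℝ (Fin n)) :
    (flatConformal u y)⁻¹ = Real.exp (-(2 * u y)) • (1 : Matrix (Fin n) (Fin n) ℝ) := by
  apply Matrix.inv_eq_right_inv
  rw [flatConformal, Matrix.smul_mul, Matrix.mul_smul, smul_smul, ← Real.exp_add]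
  simp

theorem pderiv_flatConformal {u : EuclideanSpace ℝ (Fin n) → ℝ} {y : EuclideanSpace ℝ (Fin n)}
    (hu : DifferentiableAt ℝ u y) (i j l : Fin n) :
    pderiv (fun z => flatConformal u z j l) i y =
      if j = l then Real.exp (2 * u y) * (2 * pderiv u i y) else 0 := by
  have h : HasFDerivAt (fun z => flatConformal u z j l)
      ((if j = l then (1 : ℝ) else 0) • (Real.exp (2 * u y) • ((2 : ℝ) • fderiv ℝ u y))) y := by
    convert! ((hu.hasFDerivAt.const_mul 2).exp).const_mul (if j = l then (1 : ℝ) else 0) using 1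
    ext z
    simp [flatConformal, Matrix.one_apply]
  rw [pderiv, h.fderiv]
  split_ifs <;> simp [pderiv]

theorem christoffel_flatConformal {u : EuclideanSpace ℝ (Fin n) → ℝ}
    {y : EuclideanSpace ℝ (Fin n)} (hu : DifferentiableAt ℝ u y) (k i j : Fin n) :
    christoffel (flatConformal u) k i j y = flatChristoffel (fun a => pderiv u a y) k i j := by
  simp only [christoffel, inv_flatConformal, pderiv_flatConformal hu, Matrix.smul_apply,
    Matrix.one_apply, smul_eq_mul, mul_ite, mul_one, mul_zero, ite_mul, zero_mul,
    Finset.sum_ite_eq, Finset.mem_univ, if_true, flatChristoffel, eq_comm (a := j) (b := k),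
    eq_comm (a := i) (b := k)]
  split_ifs <;> rw [Real.exp_neg] <;> field_simp <;> ring

theorem sum_flatChristoffel_mul (p : Fin n → ℝ) (j k : Fin n) :
    ∑ i, ∑ m, (flatChristoffel p i i m * flatChristoffel p m j k -
      flatChristoffel p i j m * flatChristoffel p m i k) =
      ((n : ℝ) - 2) * (p j * p k) - if j = k then ((n : ℝ) - 2) * ∑ i, p i ^ 2 else 0 := by
  simp only [flatChristoffel]
  simp [add_mul, mul_add, sub_mul, mul_sub, Finset.sum_add_distrib, Finset.sum_sub_distrib]
  simp only [eq_comm (a := k) (b := j), ← sq]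
  split_ifs <;> ring

theorem hasFDerivAt_pderiv {u : EuclideanSpace ℝ (Fin n) → ℝ} {y : EuclideanSpace ℝ (Fin n)}
    (hu : ContDiffAt ℝ 2 u y) (b : Fin n) :
    HasFDerivAt (pderiv u b) (fderiv ℝ (pderiv u b) y) y := by
  have : ContDiffAt ℝ 1 (fderiv ℝ u) y := hu.fderiv_right (by norm_num)
  exact ((this.differentiableAt (by simp)).clm_apply (differentiableAt_const _)).hasFDerivAt

/-- `flatChristoffel` is linear in `p` with constant coefficients, so differentiating it amounts to
differentiating `p`. -/
theorem pderiv_christoffel_flatConformal {u : EuclideanSpace ℝ (Fin n) → ℝ}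
    {y : EuclideanSpace ℝ (Fin n)} (hu : ContDiffAt ℝ 2 u y) (k i j a : Fin n) :
    pderiv (christoffel (flatConformal u) k i j) a y =
      flatChristoffel (fun b => pderiv (pderiv u b) a y) k i j := by
  have hev : christoffel (flatConformal u) k i j =ᶠ[nhds y]
      fun z => flatChristoffel (fun b => pderiv u b z) k i j := by
    filter_upwards [hu.eventually (by simp)] with z hz
    exact christoffel_flatConformal (hz.differentiableAt (by simp)) k i j
  have h (c : Prop) [Decidable c] (b : Fin n) :
      HasFDerivAt (fun z => if c then pderiv u b z else 0)
      (if c then fderiv ℝ (pderiv u b) y else 0) y := by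
    split_ifs
    · exact hasFDerivAt_pderiv hu b
    · exact hasFDerivAt_const _ _
  rw [pderiv, hev.fderiv_eq]
  have := ((h (k = j) i).add (h (k = i) j)).sub (h (i = j) k)
  erw [this.fderiv]
  simp only [flatChristoffel, pderiv]
  split_ifs <;> simp

theorem ricci_flatConformal {u : EuclideanSpace ℝ (Fin n) → ℝ}
    {y : EuclideanSpace ℝ (Fin n)} (hu : ContDiffAt ℝ 2 u y) (j k : Fin n)
    (hsymm : ∀ i j, pderiv (pderiv u j) i y = pderiv (pderiv u i) j y) :
    ricci (flatConformal u) y j k =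
      -((n : ℝ) - 2) * (pderiv (pderiv u k) j y - pderiv u j y * pderiv u k y) -
      if j = k then ∑ i, pderiv (pderiv u i) i y + ((n : ℝ) - 2) * ∑ i, pderiv u i y ^ 2 else 0 := by
  have hd : DifferentiableAt ℝ u y := hu.differentiableAt (by simp)
  simp only [ricci, Matrix.of_apply, riemann, christoffel_flatConformal hd,
    pderiv_christoffel_flatConformal hu]
  rw [Finset.sum_add_distrib, sum_flatChristoffel_mul]
  simp [flatChristoffel, Finset.sum_add_distrib, Finset.sum_sub_distrib]
  rw [hsymm k j]
  split_ifs <;> ring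

theorem pderiv_comm {u : EuclideanSpace ℝ (Fin n) → ℝ} {y : EuclideanSpace ℝ (Fin n)}
    (hu : ContDiffAt ℝ 2 u y) (i j : Fin n) :
    pderiv (pderiv u j) i y = pderiv (pderiv u i) j y := by
  have hd : DifferentiableAt ℝ (fderiv ℝ u) y :=
    (hu.fderiv_right (m := 1) (by norm_num)).differentiableAt (by simp)
  have key (a b : Fin n) : pderiv (pderiv u b) a y =
      fderiv ℝ (fderiv ℝ u) y (EuclideanSpace.single a 1) (EuclideanSpace.single b 1) := by
    have := hd.hasFDerivAt.clm_apply (hasFDerivAt_const (EuclideanSpace.single b (1 : ℝ)) y)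
    rw [pderiv, show pderiv u b = fun z => fderiv ℝ u z (EuclideanSpace.single b 1) from rfl,
      this.fderiv]
    simp
  rw [key, key]
  exact hu.isSymmSndFDerivAt (by simp) _ _

/-- The Laplacian terms of `Ric` and of `S g / (2(n-1))` cancel, and what remains is divisible by `n
- 2`. -/
theorem schouten_flatConformal (hn : 3 ≤ n) {u : EuclideanSpace ℝ (Fin n) → ℝ}
    {y : EuclideanSpace ℝ (Fin n)} (hu : ContDiffAt ℝ 2 u y) (j k : Fin n) :
    schouten (flatConformal u) y j k =
      -pderiv (pderiv u k) j y + pderiv u j y * pderiv u k y -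
        if j = k then (∑ i, pderiv u i y ^ 2) / 2 else 0 := by
  have hn' : (3 : ℝ) ≤ n := by exact_mod_cast hn
  have h1 : (n : ℝ) - 1 ≠ 0 := by linarith
  have h2 : (n : ℝ) - 2 ≠ 0 := by linarith
  have hS : scalarCurvature (flatConformal u) y = Real.exp (-(2 * u y)) *
      (-2 * ((n : ℝ) - 1) * ∑ i, pderiv (pderiv u i) i y -
        ((n : ℝ) - 2) * ((n : ℝ) - 1) * ∑ i, pderiv u i y ^ 2) := by
    simp only [scalarCurvature, inv_flatConformal, ricci_flatConformal hu _ _ (pderiv_comm hu),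
      Matrix.smul_apply, Matrix.one_apply, smul_eq_mul, mul_ite, mul_one, mul_zero, ite_mul,
      zero_mul, Finset.sum_ite_eq, Finset.mem_univ, if_true, ← Finset.mul_sum,
      Finset.sum_sub_distrib, Finset.sum_const, Finset.card_univ, Fintype.card_fin,
      nsmul_eq_mul, ← sq]
    ring
  simp only [schouten, Matrix.smul_apply, Matrix.sub_apply, smul_eq_mul, hS,
    ricci_flatConformal hu _ _ (pderiv_comm hu), flatConformal, Matrix.one_apply, Real.exp_neg]
  split_ifs <;> field_simp <;> ring

theorem schouten_flatConformal_apply_self (hn : 3 ≤ n) {u : EuclideanSpace ℝ (Fin n) → ℝ}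
    {y : EuclideanSpace ℝ (Fin n)} (hu : ContDiffAt ℝ 2 u y) (w : EuclideanSpace ℝ (Fin n)) :
    ∑ i, ∑ j, schouten (flatConformal u) y i j * w i * w j =
      -fderiv ℝ (fun z => fderiv ℝ u z w) y w + fderiv ℝ u y w ^ 2 -
        (∑ i, pderiv u i y ^ 2) / 2 * ‖w‖ ^ 2 := by
  have hw : w = ∑ i, w i • EuclideanSpace.single i (1 : ℝ) := by
    ext j
    simp [Pi.single_apply]
  have happ (L : EuclideanSpace ℝ (Fin n) →L[ℝ] ℝ) :
      L w = ∑ i, w i * L (EuclideanSpace.single i 1) := by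
    conv_lhs => rw [hw]
    simp
  have hH : fderiv ℝ (fun z => fderiv ℝ u z w) y w =
      ∑ i, ∑ j, w i * (w j * pderiv (pderiv u j) i y) := by
    have h1 : (fun z => fderiv ℝ u z w) = fun z => ∑ j, w j * pderiv u j z :=
      funext fun z => happ _
    rw [h1, (HasFDerivAt.fun_sum fun j _ => (hasFDerivAt_pderiv hu j).const_mul (w j)).fderiv, happ]
    simp [pderiv, Finset.mul_sum]
  rw [hH, happ, EuclideanSpace.norm_sq_eq, sq (∑ i, w i * _), Finset.sum_mul_sum,
    ← Finset.sum_neg_distrib, ← Finset.sum_add_distrib, Finset.mul_sum, ← Finset.sum_sub_distrib]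
  refine Finset.sum_congr rfl fun i _ => ?_
  simp only [schouten_flatConformal hn hu, sub_mul, add_mul, Finset.sum_sub_distrib,
    Finset.sum_add_distrib, ite_mul, zero_mul, Finset.sum_ite_eq, Finset.mem_univ, if_true]
  rw [← Finset.sum_neg_distrib]
  congr 1
  · congr 1
    · exact Finset.sum_congr rfl fun j _ => by ring
    · exact Finset.sum_congr rfl fun j _ => by simp only [pderiv]; ring
  · simp only [Real.norm_eq_abs, sq_abs]; ring

end ConformallyFlat

/-! ### The preferred charts of the sphere -/

section Chart

variable {n : ℕ}

/-- The dimension of `ℝⁿ⁺¹`, in the form used by the charts of the sphere. -/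
theorem finrank_fact (n : ℕ) :
    Fact (Module.finrank ℝ (EuclideanSpace ℝ (Fin (n + 1))) = n + 1) :=
  ⟨finrank_euclideanSpace_fin⟩

attribute [local instance] finrank_fact

/-- The isometry of `ℝⁿ` onto the hyperplane orthogonal to `x` used by the chart around `x`. -/
noncomputable def tangentIso (x : Sph n) :
    EuclideanSpace ℝ (Fin n) ≃ₗᵢ[ℝ]
      (Submodule.span ℝ {((-x : Sph n) : EuclideanSpace ℝ (Fin (n + 1)))})ᗮ :=
  (OrthonormalBasis.fromOrthogonalSpanSingleton n (ne_zero_of_mem_unit_sphere (-x))).repr.symm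

/-- `tangentIso`, with values in `ℝⁿ⁺¹`. -/
noncomputable def tangentEmb (x : Sph n) :
    EuclideanSpace ℝ (Fin n) →ₗᵢ[ℝ] EuclideanSpace ℝ (Fin (n + 1)) :=
  (Submodule.subtypeₗᵢ _).comp (tangentIso x).toLinearIsometry

theorem norm_coe_sphere (x : Sph n) : ‖(x : EuclideanSpace ℝ (Fin (n + 1)))‖ = 1 :=
  norm_eq_of_mem_sphere x

theorem inner_tangentEmb (x : Sph n) (w : EuclideanSpace ℝ (Fin n)) :
    inner ℝ (x : EuclideanSpace ℝ (Fin (n + 1))) (tangentEmb x w) = 0 := by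
  have := Submodule.mem_orthogonal_singleton_iff_inner_right.mp (tangentIso x w).2
  change inner ℝ (-x : EuclideanSpace ℝ (Fin (n + 1))) (tangentEmb x w) = 0 at this
  rwa [inner_neg_left, neg_eq_zero] at this

theorem exists_tangentEmb_eq (x : Sph n) {v : EuclideanSpace ℝ (Fin (n + 1))}
    (hv : inner ℝ (x : EuclideanSpace ℝ (Fin (n + 1))) v = 0) : ∃ w, tangentEmb x w = v := by
  have hm : v ∈ (Submodule.span ℝ {((-x : Sph n) : EuclideanSpace ℝ (Fin (n + 1)))})ᗮ := by
    rw [Submodule.mem_orthogonal_singleton_iff_inner_right]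
    simpa using hv
  exact ⟨(tangentIso x).symm ⟨v, hm⟩, congrArg Subtype.val
    ((tangentIso x).apply_symm_apply ⟨v, hm⟩)⟩

theorem param_eq (x : Sph n) (y : EuclideanSpace ℝ (Fin n)) :
    param x y = (‖y‖ ^ 2 + 4)⁻¹ • ((4 : ℝ) • tangentEmb x y +
      (4 - ‖y‖ ^ 2) • (x : EuclideanSpace ℝ (Fin (n + 1)))) := by
  have h : param x y = _ := stereographic'_symm_apply (-x) y
  have hU : ‖((tangentIso x y : _) : EuclideanSpace ℝ (Fin (n + 1)))‖ = ‖y‖ := by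
    rw [← Submodule.coe_norm, LinearIsometryEquiv.norm_map]
  change _ = (‖((tangentIso x y : _) : EuclideanSpace ℝ (Fin (n + 1)))‖ ^ 2 + 4)⁻¹ •
    (4 : ℝ) • ((tangentIso x y : _) : EuclideanSpace ℝ (Fin (n + 1))) +
    (‖((tangentIso x y : _) : EuclideanSpace ℝ (Fin (n + 1)))‖ ^ 2 + 4)⁻¹ •
    (‖((tangentIso x y : _) : EuclideanSpace ℝ (Fin (n + 1)))‖ ^ 2 - 4) •
    (-x : EuclideanSpace ℝ (Fin (n + 1))) at h
  rw [h, hU, smul_add]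
  congr 2
  module

theorem chart_target (x : Sph n) :
    (chartAt (EuclideanSpace ℝ (Fin n)) x).target = Set.univ :=
  stereographic'_target (-x)

/-- The chart around `x` projects from the antipode `-x`, so `x` sits at the origin, where the
formulas below simplify. -/
theorem coord_eq_zero (x : Sph n) : coord x = 0 := by
  have h : (chartAt (EuclideanSpace ℝ (Fin n)) x).symm 0 = x := by
    apply Subtype.ext
    have := param_eq x 0
    simpa [param, smul_smul] using this
  have h2 := (chartAt (EuclideanSpace ℝ (Fin n)) x).right_inv
    (x := 0) (by rw [chart_target]; exact Set.mem_univ _)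
  rwa [h] at h2

theorem hasFDerivAt_norm_sq (y : EuclideanSpace ℝ (Fin n)) :
    HasFDerivAt (fun z : EuclideanSpace ℝ (Fin n) => ‖z‖ ^ 2) ((2 : ℝ) • innerSL ℝ y) y := by
  simpa [ofNat_smul_eq_nsmul] using (hasStrictFDerivAt_norm_sq y).hasFDerivAt

theorem hasFDerivAt_param (x : Sph n) (y : EuclideanSpace ℝ (Fin n)) :
    HasFDerivAt (param x)
      ((‖y‖ ^ 2 + 4)⁻¹ • ((4 : ℝ) • (tangentEmb x).toContinuousLinearMap -
          ((2 : ℝ) • innerSL ℝ y).smulRight (x : EuclideanSpace ℝ (Fin (n + 1)))) +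
        (-((‖y‖ ^ 2 + 4) ^ 2)⁻¹ • (2 : ℝ) • innerSL ℝ y).smulRight ((4 : ℝ) • tangentEmb x y +
          (4 - ‖y‖ ^ 2) • (x : EuclideanSpace ℝ (Fin (n + 1))))) y := by
  have h0 := hasFDerivAt_norm_sq y
  have h1 := (hasDerivAt_inv (show ‖y‖ ^ 2 + 4 ≠ 0 by positivity)).comp_hasFDerivAt y
    (h0.add_const 4)
  have h2 := ((tangentEmb x).toContinuousLinearMap.hasFDerivAt (x := y)).const_smul (4 : ℝ)
  have h3 := (h0.const_sub 4).smul_const (x : EuclideanSpace ℝ (Fin (n + 1)))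
  convert! h1.smul (h2.add h3) using 1
  · ext1 z
    exact param_eq x z
  · ext1 w
    simp
    module

/-- Conformality of stereographic projection: `tangentEmb x` is isometric with image orthogonal to
`x`, and the remaining `y i * y j` terms cancel. The factor is `1` at the origin. -/
theorem roundMetric_eq (x : Sph n) (y : EuclideanSpace ℝ (Fin n)) :
    roundMetric x y = (4 / (‖y‖ ^ 2 + 4)) ^ 2 • (1 : Matrix (Fin n) (Fin n) ℝ) := by
  ext i j
  have hx : inner ℝ (x : EuclideanSpace ℝ (Fin (n + 1))) x = 1 := by
    rw [real_inner_self_eq_norm_sq, norm_coe_sphere]; norm_num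
  have hx' (w) : inner ℝ (tangentEmb x w) (x : EuclideanSpace ℝ (Fin (n + 1))) = 0 := by
    rw [real_inner_comm, inner_tangentEmb]
  have h4 : ‖y‖ ^ 2 + 4 ≠ 0 := by positivity
  simp only [roundMetric, coordVec, (hasFDerivAt_param x y).fderiv, Matrix.of_apply,
    Matrix.smul_apply, Matrix.one_apply]
  simp only [add_apply, smul_apply,
    sub_apply, ContinuousLinearMap.smulRight_apply, inner_add_left,
    inner_add_right, inner_sub_left, inner_sub_right, real_inner_smul_left, real_inner_smul_right,
    LinearIsometry.coe_toContinuousLinearMap, LinearIsometry.inner_map_map, hx, hx',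
    inner_tangentEmb, innerSL_apply_apply, real_inner_self_eq_norm_sq]
  simp [EuclideanSpace.inner_single_right, EuclideanSpace.inner_single_left]
  simp only [eq_comm (a := j) (b := i)]
  split_ifs <;> field_simp <;> ring

end Chart

/-! ### Radial extension of functions on the sphere -/

section RadialExtension

variable {n : ℕ}

attribute [local instance] finrank_fact

/-- The extension of a function on the sphere to `ℝⁿ⁺¹ \ {0}`, constant on rays. -/
noncomputable def radialExt (ρ : Sph n → ℝ) (p : EuclideanSpace ℝ (Fin (n + 1))) : ℝ :=
  Function.extend Subtype.val ρ 0 (‖p‖⁻¹ • p)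

theorem radialExt_coe (ρ : Sph n → ℝ) (x : Sph n) : radialExt ρ x = ρ x := by
  rw [radialExt, norm_coe_sphere, inv_one, one_smul]
  exact Subtype.val_injective.extend_apply _ _ _

theorem radialExt_smul (ρ : Sph n → ℝ) {c : ℝ} (hc : 0 < c)
    (p : EuclideanSpace ℝ (Fin (n + 1))) : radialExt ρ (c • p) = radialExt ρ p := by
  rw [radialExt, radialExt, norm_smul, smul_smul, Real.norm_of_nonneg hc.le]
  congr 2
  field_simp

/-- The chart around `x`, up to a positive scalar factor. -/
noncomputable def radialParam (x : Sph n) (y : EuclideanSpace ℝ (Fin n)) :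
    EuclideanSpace ℝ (Fin (n + 1)) :=
  tangentEmb x y + (1 - ‖y‖ ^ 2 / 4) • (x : EuclideanSpace ℝ (Fin (n + 1)))

theorem radialParam_zero (x : Sph n) : radialParam x 0 = x := by
  simp [radialParam]

/-- The extension does not see positive factors, so the rational parametrization may be replaced by
the quadratic `radialParam`. -/
theorem inChart_eq (ρ : Sph n → ℝ) (x : Sph n) (y : EuclideanSpace ℝ (Fin n)) :
    inChart ρ x y = radialExt ρ (radialParam x y) := by
  have h : param x y = (4 / (‖y‖ ^ 2 + 4)) • radialParam x y := by
    rw [param_eq, radialParam]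
    module
  rw [inChart, ← radialExt_coe ρ]
  change radialExt ρ (param x y) = _
  rw [h, radialExt_smul _ (by positivity)]

theorem hasFDerivAt_radialParam (x : Sph n) (y : EuclideanSpace ℝ (Fin n)) :
    HasFDerivAt (radialParam x) ((tangentEmb x).toContinuousLinearMap -
      ((1 / 2 : ℝ) • innerSL ℝ y).smulRight (x : EuclideanSpace ℝ (Fin (n + 1)))) y := by
  have h0 := hasFDerivAt_norm_sq y
  convert! ((tangentEmb x).toContinuousLinearMap.hasFDerivAt (x := y)).add
    (((h0.mul_const (1 / 4)).const_sub 1).smul_const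
      (x : EuclideanSpace ℝ (Fin (n + 1)))) using 1
  · ext1 z
    simp [radialParam, div_eq_mul_inv]
  · ext1 w
    simp
    module

theorem contDiffAt_inChart {ρ : Sph n → ℝ} {x : Sph n}
    (h : ContMDiffAt (𝓡 n) 𝓘(ℝ, ℝ) ∞ ρ x) : ContDiffAt ℝ ∞ (inChart ρ x) 0 := by
  have := (contMDiffAt_iff.mp h).2
  rw [← coord_eq_zero x]
  simp only [mfld_simps, contDiffWithinAt_univ] at this
  exact this

/-- Near `x` the extension is normalization, then the stereographic formula, then `inChart ρ x`. The
formula is smooth on the ambient open set `⟪v, p⟫ ≠ 1` with `v = -x`, and normalized points of that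
set avoid the pole. -/
theorem contDiffAt_radialExt {ρ : Sph n → ℝ} {x : Sph n}
    (h : ContMDiffAt (𝓡 n) 𝓘(ℝ, ℝ) ∞ ρ x) :
    ContDiffAt ℝ ∞ (radialExt ρ) (x : EuclideanSpace ℝ (Fin (n + 1))) := by
  set v : EuclideanSpace ℝ (Fin (n + 1)) := ((-x : Sph n) : EuclideanSpace ℝ (Fin (n + 1)))
    with hv
  have hx0 : (x : EuclideanSpace ℝ (Fin (n + 1))) ≠ 0 := ne_zero_of_mem_unit_sphere x
  have hvx : innerSL ℝ v (x : EuclideanSpace ℝ (Fin (n + 1))) ≠ (1 : ℝ) := by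
    rw [hv, innerSL_apply_apply, coe_neg_sphere, inner_neg_left, real_inner_self_eq_norm_sq,
      norm_coe_sphere]
    norm_num
  have hN : ContDiffAt ℝ ∞ (fun p : EuclideanSpace ℝ (Fin (n + 1)) => ‖p‖⁻¹ • p) x :=
    ((contDiffAt_norm ℝ hx0).inv (norm_ne_zero_iff.mpr hx0)).smul contDiffAt_id
  have hNx : ‖(x : EuclideanSpace ℝ (Fin (n + 1)))‖⁻¹ • (x : EuclideanSpace ℝ (Fin (n + 1))) = x := by
    rw [norm_coe_sphere, inv_one, one_smul]
  have hopen : IsOpen {p : EuclideanSpace ℝ (Fin (n + 1)) | innerSL ℝ v p ≠ (1 : ℝ)} :=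
    isOpen_ne_fun (innerSL ℝ v).continuous continuous_const
  have hS : ContDiffAt ℝ ∞ (fun q => (tangentIso x).symm (stereoToFun v q))
      (x : EuclideanSpace ℝ (Fin (n + 1))) :=
    (tangentIso x).symm.contDiff.contDiffAt.comp _
      (contDiffOn_stereoToFun.contDiffAt (hopen.mem_nhds hvx))
  have hchart (q : Sph n) : (tangentIso x).symm (stereoToFun v q) =
      chartAt (EuclideanSpace ℝ (Fin n)) x q := rfl
  have hSN : ContDiffAt ℝ ∞ (fun p : EuclideanSpace ℝ (Fin (n + 1)) =>
      (tangentIso x).symm (stereoToFun v (‖p‖⁻¹ • p))) x :=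
    ContDiffAt.comp (g := fun q => (tangentIso x).symm (stereoToFun v q)) _
      (by rw [hNx]; exact hS) hN
  have hcomp : ContDiffAt ℝ ∞ (fun p : EuclideanSpace ℝ (Fin (n + 1)) =>
      inChart ρ x ((tangentIso x).symm (stereoToFun v (‖p‖⁻¹ • p)))) x := by
    refine ContDiffAt.comp (g := inChart ρ x) _ ?_ hSN
    rw [hNx, hchart]
    change ContDiffAt ℝ ∞ (inChart ρ x) (coord x)
    rw [coord_eq_zero]
    exact contDiffAt_inChart h
  refine hcomp.congr_of_eventuallyEq ?_
  have hcont : ContinuousAt (fun p : EuclideanSpace ℝ (Fin (n + 1)) => ‖p‖⁻¹ • p) x :=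
    hN.continuousAt
  have hev := hcont.eventually_mem (by rw [hNx]; exact hopen.mem_nhds hvx)
  filter_upwards [hev, isOpen_ne.mem_nhds hx0] with p hp hp0
  have hq : ‖p‖⁻¹ • p ∈ Metric.sphere (0 : EuclideanSpace ℝ (Fin (n + 1))) 1 := by
    rw [mem_sphere_zero_iff_norm, norm_smul, norm_inv, norm_norm,
      inv_mul_cancel₀ (norm_ne_zero_iff.mpr hp0)]
  have hne : (⟨‖p‖⁻¹ • p, hq⟩ : Sph n) ∈ (chartAt (EuclideanSpace ℝ (Fin n)) x).source := by
    change _ ∈ (stereographic' n (-x)).source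
    rw [stereographic'_source]
    intro he
    apply hp
    have : ‖p‖⁻¹ • p = v := congrArg Subtype.val he
    rw [this, innerSL_apply_apply, real_inner_self_eq_norm_sq, hv, norm_coe_sphere]
    norm_num
  rw [← radialExt_smul ρ (inv_pos.mpr (norm_pos_iff.mpr hp0)) p]
  change radialExt ρ ((⟨‖p‖⁻¹ • p, hq⟩ : Sph n) : EuclideanSpace ℝ (Fin (n + 1))) =
    inChart ρ x ((tangentIso x).symm (stereoToFun v (⟨‖p‖⁻¹ • p, hq⟩ : Sph n)))
  rw [radialExt_coe, hchart, inChart, OpenPartialHomeomorph.left_inv _ hne]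

variable {ρ : Sph n → ℝ} {x : Sph n}

/-- Euler's relation in degree `0`. It makes the ambient gradient tangent to the sphere. -/
theorem fderiv_radialExt_self
    (hd : DifferentiableAt ℝ (radialExt ρ) (x : EuclideanSpace ℝ (Fin (n + 1)))) :
    fderiv ℝ (radialExt ρ) x (x : EuclideanSpace ℝ (Fin (n + 1))) = 0 := by
  have h1 : HasDerivAt (fun s : ℝ => s • (x : EuclideanSpace ℝ (Fin (n + 1))))
      (x : EuclideanSpace ℝ (Fin (n + 1))) 1 := by
    simpa using (hasDerivAt_id (1 : ℝ)).smul_const (x : EuclideanSpace ℝ (Fin (n + 1)))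
  have h2 : HasDerivAt (fun s : ℝ => radialExt ρ (s • (x : EuclideanSpace ℝ (Fin (n + 1)))))
      (fderiv ℝ (radialExt ρ) x (x : EuclideanSpace ℝ (Fin (n + 1)))) 1 :=
    HasFDerivAt.comp_hasDerivAt (l := radialExt ρ) (1 : ℝ)
      (by rw [one_smul]; exact hd.hasFDerivAt) h1
  refine h2.unique ((hasDerivAt_const (1 : ℝ) (ρ x)).congr_of_eventuallyEq ?_)
  filter_upwards [lt_mem_nhds (zero_lt_one' ℝ)] with s hs
  rw [radialExt_smul ρ hs, radialExt_coe]

theorem hasFDerivAt_inChart {y : EuclideanSpace ℝ (Fin n)}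
    (hd : DifferentiableAt ℝ (radialExt ρ) (radialParam x y)) :
    HasFDerivAt (inChart ρ x) ((fderiv ℝ (radialExt ρ) (radialParam x y)).comp
      ((tangentEmb x).toContinuousLinearMap -
      ((1 / 2 : ℝ) • innerSL ℝ y).smulRight (x : EuclideanSpace ℝ (Fin (n + 1))))) y := by
  rw [show inChart ρ x = radialExt ρ ∘ radialParam x from funext (inChart_eq ρ x)]
  exact hd.hasFDerivAt.comp y (hasFDerivAt_radialParam x y)

theorem pderiv_inChart
    (hd : DifferentiableAt ℝ (radialExt ρ) (x : EuclideanSpace ℝ (Fin (n + 1)))) (i : Fin n) :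
    pderiv (inChart ρ x) i 0 =
      inner ℝ (gradient (radialExt ρ) x) (tangentEmb x (EuclideanSpace.single i 1)) := by
  rw [pderiv, (hasFDerivAt_inChart (by rwa [radialParam_zero])).fderiv, radialParam_zero]
  simp [gradient]

theorem inner_gradient_radialExt
    (hd : DifferentiableAt ℝ (radialExt ρ) (x : EuclideanSpace ℝ (Fin (n + 1)))) :
    inner ℝ (x : EuclideanSpace ℝ (Fin (n + 1))) (gradient (radialExt ρ) x) = 0 := by
  rw [real_inner_comm, gradient, InnerProductSpace.toDual_symm_apply, fderiv_radialExt_self hd]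

/-- At the chart origin the metric is the identity, so the coordinate formula just expands the
tangent vector `gradient (radialExt ρ) x` in an orthonormal basis. -/
theorem sphereGrad_eq_gradient
    (hd : DifferentiableAt ℝ (radialExt ρ) (x : EuclideanSpace ℝ (Fin (n + 1)))) :
    sphereGrad ρ x = gradient (radialExt ρ) x := by
  obtain ⟨g, hg⟩ := exists_tangentEmb_eq x (inner_gradient_radialExt hd)
  have hc (i : Fin n) : coordVec x i 0 = tangentEmb x (EuclideanSpace.single i 1) := by
    rw [coordVec, (hasFDerivAt_param x 0).fderiv]
    simp [smul_smul]
  have hp (i : Fin n) : pderiv (inChart ρ x) i 0 = g i := by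
    rw [pderiv_inChart hd, ← hg, LinearIsometry.inner_map_map]
    simp [EuclideanSpace.inner_single_right]
  simp only [sphereGrad, coord_eq_zero, roundMetric_eq, hc, hp]
  simp only [norm_zero, ne_eq, OfNat.ofNat_ne_zero, not_false_eq_true, zero_pow, zero_add, div_self,
    one_pow, one_smul, inv_one, Matrix.one_apply, ite_mul, one_mul, zero_mul, ite_smul, zero_smul,
    Finset.sum_ite_eq, Finset.mem_univ, if_true]
  rw [← hg]
  simp only [← map_smul, ← map_sum]
  congr 1
  ext j
  simp [Pi.single_apply]

theorem sum_pderiv_inChart_sq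
    (hd : DifferentiableAt ℝ (radialExt ρ) (x : EuclideanSpace ℝ (Fin (n + 1)))) :
    ∑ i, pderiv (inChart ρ x) i 0 ^ 2 = ‖gradient (radialExt ρ) x‖ ^ 2 := by
  obtain ⟨g, hg⟩ := exists_tangentEmb_eq x (inner_gradient_radialExt hd)
  rw [← hg, LinearIsometry.norm_map, EuclideanSpace.norm_sq_eq]
  refine Finset.sum_congr rfl fun i _ => ?_
  rw [pderiv_inChart hd, ← hg, LinearIsometry.inner_map_map]
  simp [EuclideanSpace.inner_single_right]

end RadialExtension

/-! ### The Schouten tensor in terms of the radial extension -/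

section Schouten

variable {n : ℕ} {ρ : Sph n → ℝ} {x : Sph n}

theorem two_le_infty : (2 : WithTop ℕ∞) ≤ ∞ := by
  exact WithTop.coe_le_coe.2 le_top

theorem conformalMetric_eq_flatConformal (ρ : Sph n → ℝ) (x : Sph n) :
    conformalMetric ρ x =
      flatConformal (fun y => inChart ρ x y - Real.log (‖y‖ ^ 2 / 4 + 1)) := by
  funext y
  have hpos : (0 : ℝ) < ‖y‖ ^ 2 / 4 + 1 := by positivity
  rw [conformalMetric, flatConformal, roundMetric_eq, smul_smul, mul_sub, Real.exp_sub, two_mul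
    (Real.log _), Real.exp_add, Real.exp_log hpos]
  congr 1
  field_simp

theorem hasFDerivAt_log_norm_sq (y : EuclideanSpace ℝ (Fin n)) :
    HasFDerivAt (fun z : EuclideanSpace ℝ (Fin n) => Real.log (‖z‖ ^ 2 / 4 + 1))
      ((2 / (‖y‖ ^ 2 + 4)) • innerSL ℝ y) y := by
  have h0 := hasFDerivAt_norm_sq y
  have h1 := ((h0.mul_const (4 : ℝ)⁻¹).add_const 1).log (by positivity)
  convert! h1 using 1
  rw [smul_smul, smul_smul]
  congr 1
  field_simp

theorem contDiffAt_gradient {E : Type*} [NormedAddCommGroup E] [InnerProductSpace ℝ E]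
    [CompleteSpace E] {F : E → ℝ} {p : E} (hF : ContDiffAt ℝ ∞ F p) :
    ContDiffAt ℝ ∞ (gradient F) p := by
  have h1 : ContDiffAt ℝ ∞ (fderiv ℝ F) p := hF.fderiv_right (by simp)
  exact (InnerProductSpace.toDual ℝ E).symm.contDiff.contDiffAt.comp p h1

/-- The Schouten tensor of `e^{2ρ} g_{𝕊ⁿ}` in terms of the radial extension of `ρ`. -/
theorem schouten_conformalMetric_apply_self (hn : 3 ≤ n)
    (hF : ContDiffAt ℝ ∞ (radialExt ρ) (x : EuclideanSpace ℝ (Fin (n + 1))))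
    (w : EuclideanSpace ℝ (Fin n)) :
    ∑ i, ∑ j, schouten (conformalMetric ρ x) (coord x) i j * w i * w j =
      ‖w‖ ^ 2 / 2 -
        inner ℝ (fderiv ℝ (gradient (radialExt ρ)) x (tangentEmb x w)) (tangentEmb x w) +
        inner ℝ (gradient (radialExt ρ) x) (tangentEmb x w) ^ 2 -
        ‖gradient (radialExt ρ) x‖ ^ 2 / 2 * ‖w‖ ^ 2 := by
  set F := radialExt ρ with hFdef
  set u : EuclideanSpace ℝ (Fin n) → ℝ :=
    fun y => inChart ρ x y - Real.log (‖y‖ ^ 2 / 4 + 1)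
  have hd : DifferentiableAt ℝ F (x : EuclideanSpace ℝ (Fin (n + 1))) :=
    hF.differentiableAt (by simp)
  have hq0 := radialParam_zero x
  have hqc : ContDiff ℝ ∞ (radialParam x) :=
    (tangentEmb x).contDiff.add
      ((contDiff_const.sub ((contDiff_norm_sq ℝ).div_const 4)).smul contDiff_const)
  have hchart : ContDiffAt ℝ ∞ (inChart ρ x) 0 := by
    rw [show inChart ρ x = F ∘ radialParam x from funext (inChart_eq ρ x)]
    exact ContDiffAt.comp 0 (by rw [hq0]; exact hF) hqc.contDiffAt
  have huc : ContDiffAt ℝ 2 u 0 := by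
    refine (hchart.of_le two_le_infty).sub (ContDiffAt.log ?_ (by positivity))
    exact (((contDiff_norm_sq ℝ).div_const 4).add contDiff_const).contDiffAt
  have hev : ∀ᶠ y in nhds (0 : EuclideanSpace ℝ (Fin n)),
      DifferentiableAt ℝ F (radialParam x y) := by
    have h1 : ∀ᶠ p in nhds (radialParam x 0), DifferentiableAt ℝ F p := by
      rw [hq0]
      filter_upwards [(hF.of_le (m := 1) (by exact_mod_cast le_top)).eventually (by simp)] with p hp
      exact hp.differentiableAt (by simp)
    exact (hasFDerivAt_radialParam x 0).continuousAt.eventually h1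
  have hdu {y : EuclideanSpace ℝ (Fin n)} (hy : DifferentiableAt ℝ F (radialParam x y))
      (w : EuclideanSpace ℝ (Fin n)) :
      fderiv ℝ u y w = inner ℝ (gradient F (radialParam x y))
        (tangentEmb x w - (1 / 2 * inner ℝ y w) • (x : EuclideanSpace ℝ (Fin (n + 1)))) -
        2 / (‖y‖ ^ 2 + 4) * inner ℝ y w := by
    rw [((hasFDerivAt_inChart hy).fun_sub (hasFDerivAt_log_norm_sq y)).fderiv]
    simp [gradient, hFdef]
  have hdu0 (w : EuclideanSpace ℝ (Fin n)) :
      fderiv ℝ u 0 w = inner ℝ (gradient F x) (tangentEmb x w) := by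
    rw [hdu (by rwa [hq0]), hq0]
    simp
  have hp (i : Fin n) : pderiv u i 0 = pderiv (inChart ρ x) i 0 := by
    rw [pderiv_inChart hd, pderiv, hdu0]
  have hgrad : HasFDerivAt (gradient F)
      (fderiv ℝ (gradient F) (x : EuclideanSpace ℝ (Fin (n + 1)))) x :=
    ((contDiffAt_gradient hF).differentiableAt (by simp)).hasFDerivAt
  have hH : fderiv ℝ (fun y => fderiv ℝ u y w) 0 w =
      inner ℝ (fderiv ℝ (gradient F) x (tangentEmb x w)) (tangentEmb x w) - ‖w‖ ^ 2 / 2 := by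
    have hcongr : (fun y => fderiv ℝ u y w) =ᶠ[nhds 0] fun y =>
        inner ℝ (gradient F (radialParam x y))
        (tangentEmb x w - (1 / 2 * inner ℝ y w) • (x : EuclideanSpace ℝ (Fin (n + 1)))) -
        2 / (‖y‖ ^ 2 + 4) * inner ℝ y w := hev.mono fun y hy => hdu hy w
    have hin : HasFDerivAt (fun y : EuclideanSpace ℝ (Fin n) => (inner ℝ y w : ℝ))
        (innerSL ℝ w) 0 := by
      have := (innerSL ℝ w).hasFDerivAt (x := (0 : EuclideanSpace ℝ (Fin n)))
      refine this.congr_of_eventuallyEq (Filter.Eventually.of_forall fun y => ?_)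
      simp [real_inner_comm]
    have hG : HasFDerivAt (fun y => gradient F (radialParam x y))
        ((fderiv ℝ (gradient F) x).comp ((tangentEmb x).toContinuousLinearMap -
      ((1 / 2 : ℝ) • innerSL ℝ (0 : EuclideanSpace ℝ (Fin n))).smulRight
        (x : EuclideanSpace ℝ (Fin (n + 1))))) 0 :=
      HasFDerivAt.comp (g := gradient F) 0 (by rw [hq0]; exact hgrad)
        (hasFDerivAt_radialParam x 0)
    have hs := ((hin.const_mul (1 / 2)).smul_const
      (x : EuclideanSpace ℝ (Fin (n + 1)))).const_sub (tangentEmb x w)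
    have hc : DifferentiableAt ℝ
        (fun y : EuclideanSpace ℝ (Fin n) => 2 / (‖y‖ ^ 2 + 4)) 0 := by
      have : ContDiffAt ℝ 1 (fun y : EuclideanSpace ℝ (Fin n) => 2 / (‖y‖ ^ 2 + 4)) 0 :=
        contDiffAt_const.div ((contDiff_norm_sq ℝ).add contDiff_const).contDiffAt (by positivity)
      exact this.differentiableAt (by simp)
    -- The second derivative of `radialParam` points along `x`, so it contributes nothing: the chart
    -- Hessian of `ρ` at the origin is the ambient Hessian of `F` on tangent vectors. The logarithm
    -- supplies the `-‖w‖ ^ 2 / 2`.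
    have hx : inner ℝ (gradient F x) (x : EuclideanSpace ℝ (Fin (n + 1))) = 0 := by
      rw [real_inner_comm, inner_gradient_radialExt hd]
    rw [hcongr.fderiv_eq, ((hG.inner ℝ hs).fun_sub (hc.hasFDerivAt.fun_mul hin)).fderiv]
    simp [hq0, inner_smul_right, hx]
    ring
  rw [conformalMetric_eq_flatConformal, coord_eq_zero,
    schouten_flatConformal_apply_self hn huc, hH, hdu0]
  simp only [hp, sum_pderiv_inChart_sq hd]
  ring

theorem conformalMetric_apply_self (ρ : Sph n → ℝ) (x : Sph n) (w : EuclideanSpace ℝ (Fin n)) :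
    ∑ i, ∑ j, conformalMetric ρ x (coord x) i j * w i * w j =
      Real.exp (2 * ρ x) * ‖w‖ ^ 2 := by
  have h : inChart ρ x 0 = ρ x := by
    rw [inChart_eq, radialParam_zero, radialExt_coe]
  rw [coord_eq_zero, EuclideanSpace.norm_sq_eq, Finset.mul_sum]
  refine Finset.sum_congr rfl fun i _ => ?_
  simp [conformalMetric, roundMetric_eq, h, Matrix.one_apply]
  ring

end Schouten

/-! ### The differential of the representation formula -/

section Representation

/-- The representation formula for a function `F` and a vector field `G` on an inner product
space. -/
noncomputable def horoMap {E : Type*} [NormedAddCommGroup E] [InnerProductSpace ℝ E]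
    (F : E → ℝ) (G : E → E) (t : ℝ) (p : E) : ℝ × E :=
  (Real.exp (F p + t) / 2 * (1 + Real.exp (-2 * F p - 2 * t) * (1 + ‖G p‖ ^ 2))) • ((1 : ℝ), p) +
    Real.exp (-F p - t) • ((0 : ℝ), -p + G p)

variable {E : Type*} [NormedAddCommGroup E] [InnerProductSpace ℝ E] {F : E → ℝ} {G : E → E}
  {t : ℝ} {p : E}

theorem contDiffAt_horoMap {k : WithTop ℕ∞} (hF : ContDiffAt ℝ k F p) (hG : ContDiffAt ℝ k G p) :
    ContDiffAt ℝ k (horoMap F G t) p := by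
  have hc (c : ℝ) : ContDiffAt ℝ k (fun _ : E => c) p := contDiffAt_const
  refine ContDiffAt.add (ContDiffAt.fun_smul ?_ (contDiffAt_const.prodMk contDiffAt_id))
    (ContDiffAt.fun_smul ((hF.neg.sub (hc t)).exp)
      (contDiffAt_const.prodMk (contDiffAt_id.neg.add hG)))
  exact ((hF.add (hc t)).exp.div_const 2).mul ((hc 1).add
    ((((hc (-2)).mul hF).sub (hc (2 * t))).exp.mul ((hc 1).add (hG.norm_sq ℝ))))

/-- The image lies in hyperbolic space as soon as `p` is a unit vector orthogonal to `G p`. -/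
theorem horoMap_hyperbolic (hp : ‖p‖ = 1) (hG : inner ℝ p (G p) = 0) :
    -(horoMap F G t p).1 ^ 2 + ‖(horoMap F G t p).2‖ ^ 2 = -1 ∧ 0 < (horoMap F G t p).1 := by
  have e1 : Real.exp (-2 * F p - 2 * t) = (Real.exp (F p + t) ^ 2)⁻¹ := by
    rw [← Real.exp_nat_mul, ← Real.exp_neg]; congr 1; push_cast; ring
  have e2 : Real.exp (-F p - t) = (Real.exp (F p + t))⁻¹ := by
    rw [← Real.exp_neg]; congr 1; ring
  have hpp : inner ℝ p p = 1 := by rw [real_inner_self_eq_norm_sq, hp]; norm_num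
  have hGG : inner ℝ (G p) (G p) = ‖G p‖ ^ 2 := real_inner_self_eq_norm_sq _
  have hG' : inner ℝ (G p) p = 0 := by rw [real_inner_comm, hG]
  simp only [horoMap, e1, e2, Prod.fst_add, Prod.snd_add, Prod.smul_mk, smul_eq_mul, mul_one,
    mul_zero, add_zero]
  refine ⟨?_, by positivity⟩
  -- In the Minkowski product `(1, p)` is null, its product with `(0, -p + G p)` is `-1`, and the
  -- latter has square `1 + ‖G p‖ ^ 2`; the coefficients are tuned to give `-1`.
  rw [← real_inner_self_eq_norm_sq (_ + _)]
  simp only [inner_add_left, inner_add_right, real_inner_smul_left, real_inner_smul_right,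
    inner_neg_left, inner_neg_right, hpp, hG, hG', hGG]
  field_simp
  ring

/-- A direction `v ⊥ p` in the kernel of the differential of `horoMap` satisfies a quadratic
relation. -/
theorem inner_eq_of_fderiv_horoMap_eq_zero (hF : DifferentiableAt ℝ F p)
    (hG : DifferentiableAt ℝ G p) {v : E} (hpv : inner ℝ p v = 0)
    (hv : fderiv ℝ (horoMap F G t) p v = 0) :
    Real.exp (2 * t) * Real.exp (2 * F p) / 2 * ‖v‖ ^ 2 =
      ‖v‖ ^ 2 / 2 - inner ℝ (fderiv ℝ G p v) v + fderiv ℝ F p v * inner ℝ (G p) v -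
        ‖G p‖ ^ 2 / 2 * ‖v‖ ^ 2 := by
  set ψ : E → ℝ := fun q => Real.exp (F q + t) / 2 *
    (1 + Real.exp (-2 * F q - 2 * t) * (1 + ‖G q‖ ^ 2)) with hψ
  have hψd : HasFDerivAt ψ (fderiv ℝ ψ p) p := by
    refine DifferentiableAt.hasFDerivAt ?_
    simp only [hψ, div_eq_mul_inv]
    exact ((hF.add_const t).exp.mul_const (2 : ℝ)⁻¹).fun_mul
      ((((hF.const_mul (-2)).sub_const (2 * t)).exp.mul ((hG.norm_sq ℝ).const_add 1)).const_add 1)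
  have hb : HasFDerivAt (fun q => Real.exp (-F q - t))
      (Real.exp (-F p - t) • -fderiv ℝ F p) p := (hF.hasFDerivAt.neg.sub_const t).exp
  have h1 := hψd.smul ((hasFDerivAt_const (1 : ℝ) p).prodMk (hasFDerivAt_id p))
  have h2 := hb.smul ((hasFDerivAt_const (0 : ℝ) p).prodMk
    ((hasFDerivAt_id p).neg.add hG.hasFDerivAt))
  have h3 : HasFDerivAt (horoMap F G t) _ p := h1.add h2
  rw [h3.fderiv] at hv
  -- The time component gives `dψ(v) = 0`, which removes the derivative of `ψ` from the space
  -- component. Pairing that with `v ⊥ p` also removes the multiple of `p`.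
  have hfst := congrArg Prod.fst hv
  have hsnd := congrArg (fun z => inner ℝ z.2 v) hv
  simp at hfst
  simp [hfst, inner_add_left, real_inner_smul_left, hpv] at hsnd
  have e0 : Real.exp (2 * t) * Real.exp (2 * F p) = Real.exp (F p + t) ^ 2 := by
    rw [← Real.exp_nat_mul, ← Real.exp_add]; congr 1; push_cast; ring
  have e1 : Real.exp (-2 * F p - 2 * t) = (Real.exp (F p + t) ^ 2)⁻¹ := by
    rw [← Real.exp_nat_mul, ← Real.exp_neg]; congr 1; push_cast; ring
  have e2 : Real.exp (-F p - t) = (Real.exp (F p + t))⁻¹ := by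
    rw [← Real.exp_neg]; congr 1; ring
  rw [e0]
  rw [e2] at hsnd
  have hψp : ψ p = Real.exp (F p + t) / 2 *
    (1 + (Real.exp (F p + t) ^ 2)⁻¹ * (1 + ‖G p‖ ^ 2)) := by rw [hψ, ← e1]
  rw [hψp] at hsnd
  have hpos := Real.exp_pos (F p + t)
  set a := Real.exp (F p + t)
  field_simp at hsnd
  linarith

end Representation

/-! ### The immersion -/

section Immersion

variable {n : ℕ} {ρ : Sph n → ℝ} {x : Sph n}

attribute [local instance] finrank_fact

theorem phi_eq_horoMap (t : ℝ)
    (hd : DifferentiableAt ℝ (radialExt ρ) (x : EuclideanSpace ℝ (Fin (n + 1)))) :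
    phi ρ t x = horoMap (radialExt ρ) (gradient (radialExt ρ)) t x := by
  rw [phi, horoMap, sphereGrad_eq_gradient hd, radialExt_coe]

/-- The right side of the kernel relation is the Schouten form at `w`, so the upper bound gives
`(e^{2t}/2 - C) e^{2ρ} |w|² ≤ 0` with a positive coefficient. -/
theorem eq_zero_of_fderiv_horoMap_eq_zero (hn : 3 ≤ n) {C t : ℝ} (ht : 2 * C < Real.exp (2 * t))
    (hF : ContDiffAt ℝ ∞ (radialExt ρ) (x : EuclideanSpace ℝ (Fin (n + 1))))
    (hC : ∀ v : Fin n → ℝ,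
      ∑ i, ∑ j, schouten (conformalMetric ρ x) (coord x) i j * v i * v j ≤
        C * ∑ i, ∑ j, conformalMetric ρ x (coord x) i j * v i * v j)
    {v : EuclideanSpace ℝ (Fin (n + 1))}
    (hxv : inner ℝ (x : EuclideanSpace ℝ (Fin (n + 1))) v = 0)
    (hv : fderiv ℝ (horoMap (radialExt ρ) (gradient (radialExt ρ)) t) x v = 0) : v = 0 := by
  obtain ⟨w, rfl⟩ := exists_tangentEmb_eq x hxv
  have h1 := inner_eq_of_fderiv_horoMap_eq_zero (hF.differentiableAt (by simp))
    ((contDiffAt_gradient hF).differentiableAt (by simp)) hxv hv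
  have h2 := hC w
  have hfd : fderiv ℝ (radialExt ρ) x (tangentEmb x w) =
      inner ℝ (gradient (radialExt ρ) x) (tangentEmb x w) := by simp [gradient]
  rw [schouten_conformalMetric_apply_self hn hF, conformalMetric_apply_self] at h2
  rw [hfd, LinearIsometry.norm_map, radialExt_coe] at h1
  have h3 : (Real.exp (2 * t) / 2 - C) * Real.exp (2 * ρ x) * ‖w‖ ^ 2 ≤ 0 := by linarith
  have h4 : 0 < (Real.exp (2 * t) / 2 - C) * Real.exp (2 * ρ x) :=
    mul_pos (by linarith) (Real.exp_pos _)
  have h5 : ‖w‖ ^ 2 ≤ 0 := nonpos_of_mul_nonpos_right h3 h4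
  have h6 : w = 0 := by
    rw [← norm_eq_zero, ← sq_eq_zero_iff]
    exact le_antisymm h5 (sq_nonneg _)
  rw [h6, map_zero]

end Immersion

end HoroImmersion

theorem theorem3p5 (n : ℕ) (hn : 3 ≤ n) (Ω : Set (Sph n)) (hΩ : IsOpen Ω)
    (ρ : Sph n → ℝ) (hρ : ContMDiffOn (𝓡 n) 𝓘(ℝ, ℝ) ∞ ρ Ω)
    (hSch : SchoutenBoundedAbove ρ Ω) :
    ∃ t₀ : ℝ, ∀ t : ℝ, t₀ ≤ t → IsImmersionIntoHyperbolic (phi ρ t) Ω := by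
  have := finrank_fact n
  obtain ⟨C, hC⟩ := hSch
  -- For `t ≥ |C|`, `e^{2t} ≥ 2t + 1 > 2C`.
  refine ⟨|C|, fun t ht => ?_⟩
  have hexp : 2 * C < Real.exp (2 * t) := by
    have := Real.add_one_le_exp (2 * t)
    have := le_abs_self C
    linarith
  have hF {x : Sph n} (hx : x ∈ Ω) :
      ContDiffAt ℝ ∞ (radialExt ρ) (x : EuclideanSpace ℝ (Fin (n + 1))) :=
    contDiffAt_radialExt (hρ.contMDiffAt (hΩ.mem_nhds hx))
  have hd {x : Sph n} (hx : x ∈ Ω) :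
      DifferentiableAt ℝ (radialExt ρ) (x : EuclideanSpace ℝ (Fin (n + 1))) :=
    (hF hx).differentiableAt (by simp)
  set Φ := horoMap (radialExt ρ) (gradient (radialExt ρ)) t
  have hΦc {x : Sph n} (hx : x ∈ Ω) : ContDiffAt ℝ ∞ Φ (x : EuclideanSpace ℝ (Fin (n + 1))) :=
    contDiffAt_horoMap (hF hx) (contDiffAt_gradient (hF hx))
  have hcoe : ContMDiff (𝓡 n) 𝓘(ℝ, EuclideanSpace ℝ (Fin (n + 1))) ∞
      ((↑) : Sph n → EuclideanSpace ℝ (Fin (n + 1))) := contMDiff_coe_sphere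
  have heq : Set.EqOn (phi ρ t) (Φ ∘ (↑)) Ω := fun x hx => phi_eq_horoMap t (hd hx)
  refine ⟨fun x hx => ?_, fun x hx => ?_, fun x hx => ?_⟩
  · rw [heq hx]
    exact horoMap_hyperbolic (norm_coe_sphere x) (inner_gradient_radialExt (hd hx))
  · refine ContMDiffWithinAt.congr_of_mem ?_ (fun y hy => heq hy) hx
    exact ((hΦc hx).contMDiffAt.comp x hcoe.contMDiffAt).contMDiffWithinAt
  -- The two maps are only known to agree on `Ω`; openness turns this into equality near `x`, which
  -- the derivative requires.
  · have hev : phi ρ t =ᶠ[nhds x] Φ ∘ (↑) := heq.eventuallyEq_of_mem (hΩ.mem_nhds hx)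
    have hchain : mfderiv (𝓡 n) 𝓘(ℝ, Minkowski n) (phi ρ t) x =
        (fderiv ℝ Φ x).comp (mvfderiv (𝓡 n) ((↑) : Sph n → EuclideanSpace ℝ (Fin (n + 1))) x) := by
      rw [hev.mfderiv_eq, mfderiv_comp x
        ((hΦc hx).contMDiffAt.mdifferentiableAt (by simp))
        (hcoe.contMDiffAt.mdifferentiableAt (by simp)), mfderiv_eq_fderiv]
      rfl
    rw [hchain]
    refine (injective_iff_map_eq_zero _).mpr fun w hw => ?_
    have hmem : inner ℝ (x : EuclideanSpace ℝ (Fin (n + 1)))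
        (mvfderiv (𝓡 n) ((↑) : Sph n → EuclideanSpace ℝ (Fin (n + 1))) x w) = 0 := by
      -- The differential of the inclusion has range `x^⊥`, so the kernel lemma applies; its
      -- injectivity then returns to the intrinsic tangent vector.
      rw [← Submodule.mem_orthogonal_singleton_iff_inner_right, ← range_mvfderiv_subtypeVal (n := n) x]
      exact ⟨w, rfl⟩
    have h0 := eq_zero_of_fderiv_horoMap_eq_zero hn hexp (hF hx) (hC x hx) hmem hw
    exact injective_mvfderiv_subtypeVal_sphere (n := n) x (h0.trans (map_zero _).symm)
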